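/- **Theorem (regret lower bound for learning with expert advice).** For $x\in[-\frac12,\frac12]$ let $$\psi(x)=\frac{D\left(\frac12+x\,\middle\|\,\frac12\right)}{2x^2}\ \ (x\neq 0),\qquad \psi(0)=1,\qquad D(p\|q)=p\ln\frac pq+(1-p)\ln\frac{1-p}{1-q},$$ with $0\ln 0=0$, and for integers $n\ge 7$, $2\le d\le \exp(n/3)$ put $$L(n,d)=\frac{1-\exp\left(-\frac{\sqrt{\ln d}}{3.1\sqrt{2\pi}}\right)}{\sqrt{\psi\left(\frac{1.6\sqrt{\ln d}}{2\sqrt n}\right)}}\cdot\frac{\sqrt n}{2}\left(\sqrt{2\ln d-2\ln\ln d}-1\right)-\frac{\sqrt n}{2}.$$ An algorithm for learning with expert advice over $n$ rounds with $d$ actions chooses in each round $t$, possibly at random, an action $I_t\in\{1,\dots,d\}$ depending on its internal randomness and on the losses of all actions in the earlier rounds; the losses $\ell_{t,1},\dots,\ell_{t,d}\in[0,1]$ are then revealed. Its regret is $$\mathrm{Regret}^{(d)}(n)=\sum_{t=1}^n \ell_{t,I_t}-\min_{1\le i\le d}\sum_{t=1}^n \ell_{t,i}.$$ (a) Let $n\ge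 7$ and $2\le d\le\exp(n/3)$. For every (possibly randomized) algorithm there is a fixed sequence of losses $\ell_{t,i}\in\{0,1\}$, $1\le t\le n$, $1\le i\le d$, such that $$\mathbb E\left[\mathrm{Regret}^{(d)}(n)\right]\ \ge\ L(n,d),$$ where the expectation is over the algorithm's internal randomness (for a deterministic algorithm it is the regret itself). (b) The bound has asymptotically the leading term $\sqrt{\frac n2\ln d}$: for each $d \ge 2$ the limit as $n\to\infty$ below exists, and $$\lim_{d\to\infty}\ \lim_{n\to\infty}\ \frac{L(n,d)}{\sqrt{\frac n2\ln d}}=1 .$$ -/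

import Mathlib

open MeasureTheory Filter Topology

/-- The Kullback-Leibler divergence between Bernoulli distributions,
`D(p‖q) = p ln (p/q) + (1-p) ln ((1-p)/(1-q))`. -/
noncomputable def bernoulliKL (p q : ℝ) : ℝ :=
  p * Real.log (p / q) + (1 - p) * Real.log ((1 - p) / (1 - q))

/-- The ratio `ψ(x) = D(1/2 + x ‖ 1/2) / (2 x²)`, with `ψ(0) = 1` (its limit at `0`). -/
noncomputable def psi (x : ℝ) : ℝ :=
  if x = 0 then 1 else bernoulliKL (1 / 2 + x) (1 / 2) / (2 * x ^ 2)

/-- A loss sequence: `n` rounds, `d` actions, each loss in `[0,1]`. -/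
abbrev LossSeq (d n : ℕ) : Type := Fin n → Fin d → unitInterval

/-- A (possibly randomized) algorithm for `n` rounds of prediction with the advice of `d` experts.
`Ω` is the space of its internal randomness. In round `t` the action chosen is a function of
the randomness and of the losses of all actions in the rounds before `t` (the algorithm's own
earlier actions are themselves functions of these data). -/
structure ExpertAlgorithm (d n : ℕ) (Ω : Type*) [MeasurableSpace Ω] where
  choose : (t : Fin n) → (Fin t → Fin d → unitInterval) → Ω → Fin d
  measurable_choose : ∀ t h, Measurable (choose t h)

namespace ExpertAlgorithm

variable {d n : ℕ} {Ω : Type*} [MeasurableSpace Ω]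

/-- The action `I_t` chosen in round `t` when the loss sequence is `l`. -/
def action (A : ExpertAlgorithm d n Ω) (l : LossSeq d n) (t : Fin n) (ω : Ω) : Fin d :=
  A.choose t (fun s => l (Fin.castLE t.isLt.le s)) ω

/-- The regret `∑ₜ l(t, I_t) - min_i ∑ₜ l(t, i)`. -/
noncomputable def regret (A : ExpertAlgorithm d n Ω) (l : LossSeq d n) (ω : Ω) : ℝ :=
  ∑ t, (l t (A.action l t ω) : ℝ) - ⨅ i, ∑ t, (l t i : ℝ)

/-- The regret is integrable, so that its expectation is meaningful. -/
theorem integrable_regret (A : ExpertAlgorithm d n Ω) (l : LossSeq d n)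
    (P : Measure Ω) [IsProbabilityMeasure P] : Integrable (A.regret l) P := by
  unfold regret
  refine (integrable_finsetSum _ fun t _ => ?_).sub (integrable_const _)
  refine Integrable.of_bound (C := 1) ?_ (Eventually.of_forall fun ω => ?_)
  · exact ((measurable_of_finite (fun i : Fin d => (l t i : ℝ))).comp
      (A.measurable_choose t _)).aestronglyMeasurable
  · rw [Real.norm_of_nonneg (l t _).2.1]
    exact (l t _).2.2

end ExpertAlgorithm

/-- The explicit lower bound on the regret over `n` rounds with `d` experts. -/
noncomputable def regretBound (n d : ℕ) : ℝ :=
  (1 - Real.exp (-(√(Real.log d) / (3.1 * √(2 * Real.pi))))) /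
      √(psi (1.6 * √(Real.log d) / (2 * √n))) *
    (√n / 2) * (√(2 * Real.log d - 2 * Real.log (Real.log d)) - 1) - √n / 2

/-! The losses are averaged over independent fair bits. The loss of round `t` is independent of the
past, so every algorithm loses `n/2` on average, and its mean regret is the mean of `halfRegret`,
the largest of `d` independent centred binomials. Some fixed sequence does at least as well as the
average (`exists_le_integral_regret`).

Let `p` be the probability that one action beats `n/2` by `κ`. Some action does so with probability
`1 - (1 - p)^d`; otherwise action `0` is used, at a cost of at most `√n / 2` on average
(`sum_halfRegret_ge`). With `l = ln d`, `Y = √(2l - 2 ln l)` and `q = √ψ`, take `κ = √n (Y - 1) /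
(2q)` and `κ' = √n Y / (2q)`. Up to `κ'` the entropy exponent is at most `Y² / 2 = l - ln l`, so by
Stirling each binomial weight is at least `(3/5) l / (d √n)`. The window has width `√n / (2q)`,
hence `p ≥ √l / (7d)` (`lowerTail_ge`, `sum_regretBound_le`). These estimates need `l > 6`; for `l ≤
6` the bound is nonpositive and the average regret is not negative. -/

/-! ### The function `psi` -/

/-- The power series of the relative entropy `D(1/2 + x ‖ 1/2)` in `2x`. -/
theorem hasSum_bernoulliKL_half {x : ℝ} (hx : |x| < 1 / 2) :
    HasSum (fun k : ℕ => (2 * x) ^ (2 * k + 2) / (2 * ((k + 1 : ℝ) * (2 * k + 1))))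
      (bernoulliKL (1 / 2 + x) (1 / 2)) := by
  obtain ⟨h1, h2⟩ := abs_lt.1 hx
  have hu : |2 * x| < 1 := by rw [abs_lt]; constructor <;> linarith
  have hsq : |(2 * x) ^ 2| < 1 := by
    rw [abs_pow]; exact pow_lt_one₀ (abs_nonneg _) hu two_ne_zero
  -- With `u = 2x`, the entropy is `½ ln (1 - u²) + x (ln (1 + u) - ln (1 - u))`.
  have hA := (Real.hasSum_pow_div_log_of_abs_lt_one hsq).mul_left (-(1 / 2))
  have hB := (Real.hasSum_log_sub_log_of_abs_lt_one hu).mul_left x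
  have hp : 0 < 1 + 2 * x := by linarith
  have hm : 0 < 1 - 2 * x := by linarith
  convert! hA.add hB using 1
  · funext k
    have : (k + 1 : ℝ) ≠ 0 := by positivity
    have : (2 * k + 1 : ℝ) ≠ 0 := by positivity
    rw [pow_add _ (2 * k), pow_succ _ (2 * k), pow_succ _ k, pow_mul]
    generalize ((2 * x) ^ 2) ^ k = z
    field_simp
    ring
  · unfold bernoulliKL
    rw [show (1 / 2 + x) / (1 / 2) = 1 + 2 * x by ring,
      show (1 - (1 / 2 + x)) / (1 - 1 / 2) = 1 - 2 * x by ring,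
      show 1 - (2 * x) ^ 2 = (1 + 2 * x) * (1 - 2 * x) by ring, Real.log_mul hp.ne' hm.ne']
    ring

/-- The power series of `psi` in `2x`. -/
theorem hasSum_psi {x : ℝ} (hx : |x| < 1 / 2) :
    HasSum (fun k : ℕ => (2 * x) ^ (2 * k) / ((k + 1 : ℝ) * (2 * k + 1))) (psi x) := by
  by_cases h0 : x = 0
  · subst h0
    convert hasSum_single (f := fun k : ℕ => (2 * (0 : ℝ)) ^ (2 * k) / ((k + 1 : ℝ) * (2 * k + 1)))
      0 ?_ using 1
    · simp [psi]
    · intro k hk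
      simp [hk]
  · rw [psi, if_neg h0]
    convert! (hasSum_bernoulliKL_half hx).div_const (2 * x ^ 2) using 1
    funext k
    have : (k + 1 : ℝ) ≠ 0 := by positivity
    have : (2 * k + 1 : ℝ) ≠ 0 := by positivity
    field_simp
    ring

theorem psi_le_psi {x y : ℝ} (hx : 0 ≤ x) (hxy : x ≤ y) (hy : y < 1 / 2) : psi x ≤ psi y := by
  refine hasSum_le (fun k => ?_) (hasSum_psi (x := x) ?_) (hasSum_psi (x := y) ?_)
  · gcongr
  · rw [abs_of_nonneg hx]; linarith
  · rwa [abs_of_nonneg (hx.trans hxy)]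

theorem one_le_psi {x : ℝ} (hx : |x| < 1 / 2) : 1 ≤ psi x := by
  have := (hasSum_psi hx).summable.sum_le_tsum {0} fun k _ => by
    rw [pow_mul]; positivity
  rw [(hasSum_psi hx).tsum_eq] at this
  simpa using this

theorem psi_le_inv {x : ℝ} (hx : |x| < 1 / 2) : psi x ≤ (1 - (2 * x) ^ 2)⁻¹ := by
  have hsq : (2 * x) ^ 2 < 1 := by
    rw [← sq_abs, abs_mul, abs_two]
    exact pow_lt_one₀ (by positivity) (by linarith) two_ne_zero
  refine hasSum_le (fun k => ?_) (hasSum_psi hx) (hasSum_geometric_of_lt_one (sq_nonneg _) hsq)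
  rw [pow_mul]
  refine div_le_self (by positivity) ?_
  have : (0 : ℝ) ≤ k := k.cast_nonneg
  nlinarith

/-- Applying `ln y ≤ y - 1` to both logarithms bounds the entropy by `4x²`. -/
theorem psi_le_two {x : ℝ} (hx : |x| < 1 / 2) : psi x ≤ 2 := by
  by_cases h0 : x = 0
  · simp [psi, h0]
  · obtain ⟨h1, h2⟩ := abs_lt.1 hx
    have hp : 0 < 1 + 2 * x := by linarith
    have hm : 0 < 1 - 2 * x := by linarith
    rw [psi, if_neg h0, div_le_iff₀ (by positivity)]
    unfold bernoulliKL
    rw [show (1 / 2 + x) / (1 / 2) = 1 + 2 * x by ring,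
      show (1 - (1 / 2 + x)) / (1 - 1 / 2) = 1 - 2 * x by ring]
    nlinarith [Real.log_le_sub_one_of_pos hp, Real.log_le_sub_one_of_pos hm]

theorem tendsto_psi_zero : Tendsto psi (𝓝 0) (𝓝 1) := by
  have hx : ∀ᶠ x : ℝ in 𝓝 0, |x| < 1 / 2 := by
    have := Metric.ball_mem_nhds (0 : ℝ) (show (0 : ℝ) < 1 / 2 by norm_num)
    filter_upwards [this] with x h
    simpa using h
  refine tendsto_of_tendsto_of_tendsto_of_le_of_le' (h := fun x => (1 - (2 * x) ^ 2)⁻¹)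
    tendsto_const_nhds ?_ (hx.mono fun x => one_le_psi) (hx.mono fun x => psi_le_inv)
  have : ContinuousAt (fun x : ℝ => (1 - (2 * x) ^ 2)⁻¹) 0 :=
    ContinuousAt.inv₀ (by fun_prop) (by norm_num)
  simpa [ContinuousAt] using this

/-! ### Binomial weights and moments -/

/-- The binomial coefficient is at least its entropy estimate, up to a factor `√n`. -/
theorem choose_div_two_pow_ge {n k : ℕ} (hk : 0 < k) (hkn : k < n) :
    3 / 5 / √n * Real.exp (-(n * bernoulliKL (1 / 2 + (1 / 2 - k / n)) (1 / 2))) ≤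
      n.choose k / 2 ^ n := by
  obtain ⟨j, rfl⟩ := Nat.exists_eq_add_of_le hkn.le
  have hj0 : 0 < j := by omega
  have hkR : (0 : ℝ) < k := by exact_mod_cast hk
  have hjR : (0 : ℝ) < j := by exact_mod_cast hj0
  have upper : ∀ i : ℕ, 0 < i → (i.factorial : ℝ) ≤ Real.exp 1 * √i * (i / Real.exp 1) ^ i := by
    intro i hi
    obtain ⟨i, rfl⟩ := Nat.exists_eq_succ_of_ne_zero hi.ne'
    -- The Stirling sequence decreases from its first value `e / √2`.
    have h := Stirling.stirlingSeq'_antitone (Nat.zero_le i)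
    change Stirling.stirlingSeq (i + 1) ≤ Stirling.stirlingSeq 1 at h
    rw [Stirling.stirlingSeq_one, Stirling.stirlingSeq,
      div_le_iff₀ (by positivity)] at h
    refine h.trans (le_of_eq ?_)
    push_cast
    rw [Real.sqrt_mul zero_le_two]
    field_simp
  have lower := Stirling.le_factorial_stirling (k + j)
  have hchoose : ((k + j).choose k : ℝ) * (k.factorial * j.factorial) = (k + j).factorial := by
    have := Nat.add_choose_mul_factorial_mul_factorial k j
    rw [← this, Nat.choose_symm_add]; push_cast; ring
  have hexp : Real.exp (-(((k + j : ℕ) : ℝ) *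
      bernoulliKL (1 / 2 + (1 / 2 - k / ((k + j : ℕ) : ℝ))) (1 / 2))) =
      ((k + j : ℝ) ^ (k + j)) / (2 ^ (k + j) * (k ^ k * j ^ j)) := by
    unfold bernoulliKL
    push_cast
    rw [show (1 / 2 + (1 / 2 - (k : ℝ) / (k + j))) = j / (k + j) by field_simp; ring,
      show 1 - (j : ℝ) / (k + j) = k / (k + j) by field_simp; ring]
    rw [show (j : ℝ) / (k + j) / (1 / 2) = 2 * j / (k + j) by ring,
      show (k : ℝ) / (k + j) / (1 - 1 / 2) = 2 * k / (k + j) by ring]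
    rw [show -(((k : ℝ) + j) * (j / (k + j) * Real.log (2 * j / (k + j)) +
      k / (k + j) * Real.log (2 * k / (k + j)))) = -(j * Real.log (2 * j / (k + j)) +
      k * Real.log (2 * k / (k + j))) by field_simp]
    rw [Real.exp_neg, Real.exp_add, Real.exp_nat_mul, Real.exp_nat_mul, Real.exp_log (by positivity),
      Real.exp_log (by positivity), div_pow, div_pow, mul_pow, mul_pow, pow_add 2, pow_add (_ + _)]
    field_simp
  rw [hexp]
  push_cast
  set N : ℝ := (k : ℝ) + j with hN
  have hNpos : 0 < N := by positivity
  have hsqrt : √(k : ℝ) * √j ≤ N / 2 := by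
    rw [← Real.sqrt_mul hkR.le]
    exact Real.sqrt_le_iff.2 ⟨by positivity, by nlinarith [sq_nonneg ((k : ℝ) - j)]⟩
  have hpi : (5 / 2 : ℝ) ≤ √(2 * Real.pi) :=
    Real.le_sqrt_of_sq_le (by linarith [Real.pi_gt_d2])
  have hE : Real.exp 1 ^ 2 ≤ 8 := by
    nlinarith [Real.exp_one_lt_d9, Real.exp_pos 1]
  have hmul : (k.factorial : ℝ) * j.factorial ≤
      (Real.exp 1 ^ 2 * (N / 2)) * ((k : ℝ) ^ k * j ^ j / Real.exp 1 ^ (k + j)) := by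
    calc (k.factorial : ℝ) * j.factorial
        ≤ (Real.exp 1 * √k * (k / Real.exp 1) ^ k) * (Real.exp 1 * √j * (j / Real.exp 1) ^ j) :=
          mul_le_mul (upper k hk) (upper j hj0) (by positivity) (by positivity)
      _ = (Real.exp 1 ^ 2 * (√k * √j)) * ((k : ℝ) ^ k * j ^ j / Real.exp 1 ^ (k + j)) := by
          rw [div_pow, div_pow, pow_add]; ring
      _ ≤ _ := by gcongr
  push_cast at lower
  rw [← hN, div_pow] at lower
  rw [le_div_iff₀ (by positivity)]
  have hC : ((k + j).choose k : ℝ) = (k + j).factorial / (k.factorial * j.factorial) := by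
    rw [← hchoose]; field_simp
  rw [hC, le_div_iff₀ (by positivity)]
  refine le_trans ?_ lower
  refine (mul_le_mul_of_nonneg_left hmul (by positivity)).trans ?_
  rw [Real.sqrt_mul (by positivity)]
  have hs : √N * √N = N := Real.mul_self_sqrt hNpos.le
  -- The constant `3/5` works because `(3/10) e² ≤ 2.4 < 5/2 ≤ √(2π)`.
  have key : 3 / 5 / √N * (Real.exp 1 ^ 2 * (N / 2)) ≤ √(2 * Real.pi) * √N := by
    nth_rw 2 [← hs]
    rw [show 3 / 5 / √N * (Real.exp 1 ^ 2 * (√N * √N / 2)) = 3 / 10 * Real.exp 1 ^ 2 * √N by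
      field_simp; ring]
    gcongr
    linarith
  calc _ = (3 / 5 / √N * (Real.exp 1 ^ 2 * (N / 2))) * (N ^ (k + j) / Real.exp 1 ^ (k + j)) := by
        field_simp
    _ ≤ _ := by gcongr

/-- Second moment of the centred cardinality of a uniformly random subset. -/
theorem sum_sq_half_sub_card (n : ℕ) :
    ∑ c : Finset (Fin n), ((n : ℝ) / 2 - c.card) ^ 2 = (2 : ℝ) ^ n * (n / 4) := by
  -- Bernstein polynomials at `1/2` are the fair binomial weights.
  have h := congrArg (Polynomial.eval (1 / 2 : ℝ)) (bernsteinPolynomial.variance ℝ n)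
  simp only [Polynomial.eval_finsetSum, bernsteinPolynomial, Polynomial.eval_mul,
    Polynomial.eval_pow, Polynomial.eval_sub, Polynomial.eval_X,
    Polynomial.eval_natCast, Polynomial.eval_one, nsmul_eq_mul] at h
  rw [← Finset.powerset_univ,
    Finset.sum_powerset_apply_card (fun m : ℕ => ((n : ℝ) / 2 - m) ^ 2), Finset.card_univ,
    Fintype.card_fin]
  have h2 : (2 : ℝ) ^ n * (n * (1 / 2) * (1 - 1 / 2)) = 2 ^ n * (n / 4) := by ring
  rw [← h2, ← h, Finset.mul_sum]
  refine Finset.sum_congr rfl fun m hm => ?_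
  have hm' : m ≤ n := Nat.lt_succ_iff.1 (Finset.mem_range.1 hm)
  have h3 : (1 / 2 : ℝ) ^ m * (1 - 1 / 2) ^ (n - m) * 2 ^ n = 1 := by
    rw [show (1 - 1 / 2 : ℝ) = 1 / 2 by norm_num, ← pow_add, Nat.add_sub_cancel' hm', ← mul_pow]
    norm_num
  rw [nsmul_eq_mul]
  linear_combination (-(n.choose m : ℝ) * ((n : ℝ) / 2 - m) ^ 2) * h3

/-- Cauchy–Schwarz and the variance `n/4`. -/
theorem sum_abs_half_sub_card_le (n : ℕ) :
    ∑ c : Finset (Fin n), |(n : ℝ) / 2 - c.card| ≤ (2 : ℝ) ^ n * (√n / 2) := by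
  refine abs_le_of_sq_le_sq' ?_ (by positivity) |>.2
  have h := sq_sum_le_card_mul_sum_sq (s := (Finset.univ : Finset (Finset (Fin n))))
    (f := fun c => |(n : ℝ) / 2 - c.card|)
  simp only [sq_abs, sum_sq_half_sub_card, Finset.card_univ, Fintype.card_finset,
    Fintype.card_fin] at h
  refine h.trans (le_of_eq ?_)
  rw [mul_pow, div_pow, Real.sq_sqrt n.cast_nonneg]
  push_cast
  ring

/-! ### Averaging over random binary losses -/

/-- The loss sequence in which `b i` is the set of rounds where action `i` has loss `1`. -/
def lossOfSets {d n : ℕ} (b : Fin d → Finset (Fin n)) : LossSeq d n :=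
  fun t i => if t ∈ b i then 1 else 0

theorem coe_lossOfSets {d n : ℕ} (b : Fin d → Finset (Fin n)) (t : Fin n) (i : Fin d) :
    (lossOfSets b t i : ℝ) = if t ∈ b i then 1 else 0 := by
  unfold lossOfSets
  split_ifs <;> rfl

theorem sum_lossOfSets {d n : ℕ} (b : Fin d → Finset (Fin n)) (i : Fin d) :
    ∑ t, (lossOfSets b t i : ℝ) = (b i).card := by
  simp [coe_lossOfSets]

/-- Flipping all losses of round `t`. -/
def flipRound {d n : ℕ} (t : Fin n) (b : Fin d → Finset (Fin n)) : Fin d → Finset (Fin n) :=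
  fun i => symmDiff (b i) {t}

theorem flipRound_involutive {d n : ℕ} (t : Fin n) :
    Function.Involutive (flipRound (d := d) t) := fun b => by
  funext i
  simp [flipRound]

theorem lossOfSets_flipRound_of_ne {d n : ℕ} {s t : Fin n} (h : s ≠ t)
    (b : Fin d → Finset (Fin n)) : lossOfSets (flipRound t b) s = lossOfSets b s := by
  funext i
  simp [lossOfSets, flipRound, Finset.mem_symmDiff, h]

theorem coe_lossOfSets_flipRound {d n : ℕ} (t : Fin n) (b : Fin d → Finset (Fin n)) (i : Fin d) :
    (lossOfSets (flipRound t b) t i : ℝ) = 1 - lossOfSets b t i := by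
  by_cases h : t ∈ b i <;> simp [coe_lossOfSets, flipRound, Finset.mem_symmDiff, h]

/-- Against uniformly random binary losses every algorithm has mean loss `1/2` per round. -/
theorem ExpertAlgorithm.sum_loss_lossOfSets {d n : ℕ} {Ω : Type*} [MeasurableSpace Ω]
    (A : ExpertAlgorithm d n Ω) (t : Fin n) (ω : Ω) :
    ∑ b : Fin d → Finset (Fin n), (lossOfSets b t (A.action (lossOfSets b) t ω) : ℝ) =
      ∑ _b : Fin d → Finset (Fin n), 1 / 2 := by
  -- Flipping round `t` keeps the earlier losses, hence the action, and turns its loss `x` into `1 -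
  -- x`. As the flip is a bijection, the sum equals its own complement.
  have hact : ∀ b : Fin d → Finset (Fin n),
      A.action (lossOfSets (flipRound t b)) t ω = A.action (lossOfSets b) t ω := by
    intro b
    unfold ExpertAlgorithm.action
    congr 1
    funext s
    refine lossOfSets_flipRound_of_ne (fun h => ?_) b
    have := congrArg Fin.val h
    simp only [Fin.val_castLE] at this
    exact absurd this s.isLt.ne
  have h := Equiv.sum_comp (flipRound_involutive (d := d) t).toPerm
    fun b => (lossOfSets b t (A.action (lossOfSets b) t ω) : ℝ)
  simp only [Function.Involutive.coe_toPerm, hact, coe_lossOfSets_flipRound,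
    Finset.sum_sub_distrib] at h
  have h2 : ∑ _b : Fin d → Finset (Fin n), (1 : ℝ) =
      2 * ∑ _b : Fin d → Finset (Fin n), (1 / 2 : ℝ) := by
    rw [Finset.mul_sum]; norm_num
  linarith

/-- The regret against the best action when the algorithm loses exactly `n/2`. -/
noncomputable def halfRegret {d n : ℕ} (b : Fin d → Finset (Fin n)) : ℝ :=
  n / 2 - ⨅ i, ((b i).card : ℝ)

theorem ExpertAlgorithm.sum_regret_lossOfSets {d n : ℕ} {Ω : Type*} [MeasurableSpace Ω]
    (A : ExpertAlgorithm d n Ω) (ω : Ω) :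
    ∑ b : Fin d → Finset (Fin n), A.regret (lossOfSets b) ω =
      ∑ b : Fin d → Finset (Fin n), halfRegret b := by
  simp only [ExpertAlgorithm.regret, halfRegret, sum_lossOfSets, Finset.sum_sub_distrib]
  congr 1
  rw [Finset.sum_comm]
  simp only [A.sum_loss_lossOfSets]
  simp
  ring

/-- An average lower bound for `halfRegret` yields a binary loss sequence with large regret. -/
theorem ExpertAlgorithm.exists_le_integral_regret {d n : ℕ} {Ω : Type*} [MeasurableSpace Ω]
    (A : ExpertAlgorithm d n Ω) (P : Measure Ω) [IsProbabilityMeasure P] {c : ℝ}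
    (hc : ∑ _b : Fin d → Finset (Fin n), c ≤ ∑ b : Fin d → Finset (Fin n), halfRegret b) :
    ∃ l : LossSeq d n, (∀ t i, l t i = 0 ∨ l t i = 1) ∧ c ≤ ∫ ω, A.regret l ω ∂P := by
  have h : ∑ b : Fin d → Finset (Fin n), ∫ ω, A.regret (lossOfSets b) ω ∂P =
      ∑ b : Fin d → Finset (Fin n), halfRegret b := by
    -- After exchanging sum and integral, the sum over `b` no longer depends on `ω`.
    rw [← integral_finsetSum _ fun b _ => A.integrable_regret _ P]
    simp only [A.sum_regret_lossOfSets]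
    simp
  rw [← h] at hc
  obtain ⟨b, -, hb⟩ := Finset.exists_le_of_sum_le Finset.univ_nonempty hc
  refine ⟨lossOfSets b, fun t i => ?_, hb⟩
  unfold lossOfSets
  split_ifs <;> simp

/-! ### From the binomial tail to the expected maximum -/

/-- The probability that a uniformly random subset of `Fin n` is smaller than `n/2` by at
least `κ`. -/
noncomputable def lowerTail (n : ℕ) (κ : ℝ) : ℝ :=
  (Finset.univ.filter fun c : Finset (Fin n) => κ ≤ n / 2 - c.card).card / 2 ^ n

theorem halfRegret_ge {d n : ℕ} (b : Fin d → Finset (Fin n)) (i : Fin d) :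
    (n : ℝ) / 2 - (b i).card ≤ halfRegret b := by
  unfold halfRegret
  have := ciInf_le (Set.finite_range fun i => ((b i).card : ℝ)).bddBelow i
  linarith

/-- If some action reaches `κ`, the best one does; if none does, action `0` still gives at least
`-|n/2 - card|`. Subtracting this absolute value in both cases avoids conditioning, and independence
gives the power `d`. -/
theorem sum_halfRegret_ge {d n : ℕ} (hd : 0 < d) (κ : ℝ) :
    ∑ _b : Fin d → Finset (Fin n), (κ * (1 - (1 - lowerTail n κ) ^ d) - √n / 2) ≤
      ∑ b : Fin d → Finset (Fin n), halfRegret b := by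
  classical
  obtain ⟨d, rfl⟩ := Nat.exists_eq_succ_of_ne_zero hd.ne'
  set T : Finset (Finset (Fin n)) := Finset.univ.filter fun c => κ ≤ n / 2 - c.card with hT
  have hcard : ∑ b : Fin (d + 1) → Finset (Fin n), (if ∀ i, b i ∈ Tᶜ then (1 : ℝ) else 0) =
      (2 ^ n) ^ (d + 1) * (1 - lowerTail n κ) ^ (d + 1) := by
    have h1 : (Finset.univ.filter fun b : Fin (d + 1) → Finset (Fin n) => ∀ i, b i ∈ Tᶜ) =
        Fintype.piFinset fun _ => Tᶜ := by
      ext b; simp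
    have h2 : ((Tᶜ).card : ℝ) = 2 ^ n * (1 - lowerTail n κ) := by
      have h3 := Finset.card_add_card_compl T
      rw [Fintype.card_finset, Fintype.card_fin] at h3
      have h4 : (T.card : ℝ) + (Tᶜ).card = 2 ^ n := by exact_mod_cast h3
      rw [lowerTail, ← hT]
      field_simp
      linarith
    rw [Finset.sum_boole, h1, Fintype.card_piFinset]
    simp [h2, mul_pow]
  have habs : ∑ b : Fin (d + 1) → Finset (Fin n), |(n : ℝ) / 2 - (b 0).card| ≤
      (2 ^ n) ^ (d + 1) * (√n / 2) := by
    -- Splitting off action `0` leaves a free sum over the others.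
    rw [← (Fin.consEquiv fun _ : Fin (d + 1) => Finset (Fin n)).sum_comp, Fintype.sum_prod_type]
    simp only [Fin.consEquiv_apply, Fin.cons_zero, Finset.sum_const, Finset.card_univ,
      Fintype.card_pi, Fintype.card_finset, Fintype.card_fin, Finset.prod_const, nsmul_eq_mul]
    rw [← Finset.mul_sum, pow_succ, mul_assoc]
    push_cast
    exact mul_le_mul_of_nonneg_left (sum_abs_half_sub_card_le n) (by positivity)
  have hpt : ∀ b : Fin (d + 1) → Finset (Fin n),
      κ * (1 - if ∀ i, b i ∈ Tᶜ then 1 else 0) - |(n : ℝ) / 2 - (b 0).card| ≤ halfRegret b := by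
    intro b
    split_ifs with h
    · have := halfRegret_ge b 0
      have := neg_abs_le ((n : ℝ) / 2 - (b 0).card)
      linarith
    · push Not at h
      obtain ⟨i, hi⟩ := h
      have hi' : κ ≤ n / 2 - (b i).card := by simpa [hT] using hi
      have := halfRegret_ge b i
      have := abs_nonneg ((n : ℝ) / 2 - (b 0).card)
      linarith
  have hsum : ∑ b : Fin (d + 1) → Finset (Fin n),
      (κ * (1 - if ∀ i, b i ∈ Tᶜ then 1 else 0) - |(n : ℝ) / 2 - (b 0).card|) =
      κ * ((2 ^ n) ^ (d + 1) - (2 ^ n) ^ (d + 1) * (1 - lowerTail n κ) ^ (d + 1)) -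
        ∑ b : Fin (d + 1) → Finset (Fin n), |(n : ℝ) / 2 - (b 0).card| := by
    rw [Finset.sum_sub_distrib, ← Finset.mul_sum, Finset.sum_sub_distrib, hcard]
    simp
  refine le_trans ?_ (Finset.sum_le_sum fun b _ => hpt b)
  rw [hsum]
  simp only [Finset.sum_const, Finset.card_univ, Fintype.card_pi, Fintype.card_finset,
    Fintype.card_fin, Finset.prod_const, nsmul_eq_mul, Nat.succ_eq_add_one]
  push_cast
  linarith

theorem bernoulliKL_half_eq (x : ℝ) : bernoulliKL (1 / 2 + x) (1 / 2) = 2 * x ^ 2 * psi x := by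
  by_cases h : x = 0
  · subst h
    norm_num [bernoulliKL]
  · rw [psi, if_neg h]
    field_simp

theorem lowerTail_eq (n : ℕ) (κ : ℝ) :
    lowerTail n κ =
      ∑ k ∈ (Finset.range (n + 1)).filter (fun k : ℕ => κ ≤ (n : ℝ) / 2 - k),
        (n.choose k : ℝ) / 2 ^ n := by
  rw [lowerTail, ← Finset.sum_div, ← Finset.sum_boole, ← Finset.powerset_univ,
    Finset.sum_powerset_apply_card (fun m : ℕ => if κ ≤ (n : ℝ) / 2 - m then (1 : ℝ) else 0),
    Finset.card_univ, Fintype.card_fin, Finset.sum_filter]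
  simp

theorem lowerTail_nonneg (n : ℕ) (κ : ℝ) : 0 ≤ lowerTail n κ := by
  unfold lowerTail; positivity

theorem lowerTail_le_one (n : ℕ) (κ : ℝ) : lowerTail n κ ≤ 1 := by
  unfold lowerTail
  refine div_le_one_of_le₀ ?_ (by positivity)
  have := Finset.card_le_univ (Finset.univ.filter fun c : Finset (Fin n) => κ ≤ n / 2 - c.card)
  rw [Fintype.card_finset, Fintype.card_fin] at this
  exact_mod_cast this

/-- The window `[κ, κ']` contributes at least `κ' - κ - 1` binomial terms to the tail. -/
theorem lowerTail_ge {n : ℕ} {κ κ' E : ℝ} (hκ : 0 ≤ κ) (hκ' : κ' < n / 2)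
    (hE : ∀ v : ℝ, 0 ≤ v → v ≤ κ' → n * bernoulliKL (1 / 2 + v / n) (1 / 2) ≤ E) :
    (κ' - κ - 1) * (3 / 5 / √n * Real.exp (-E)) ≤ lowerTail n κ := by
  -- For a window of width at most `1` the left side is nonpositive. A wider one forces `n > 0` and
  -- guarantees `a ≤ b + 1` in the count below.
  rcases le_or_gt (κ' - κ) 1 with h1 | h1
  · refine le_trans (mul_nonpos_of_nonpos_of_nonneg (by linarith) (by positivity))
      (lowerTail_nonneg n κ)
  have hn : (0 : ℝ) < n := by linarith
  rw [lowerTail_eq]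
  set a := ⌈(n : ℝ) / 2 - κ'⌉₊ with ha
  set b := ⌊(n : ℝ) / 2 - κ⌋₊ with hb
  have ha1 : (a : ℝ) < n / 2 - κ' + 1 := Nat.ceil_lt_add_one (by linarith)
  have hb1 : (n : ℝ) / 2 - κ < b + 1 := Nat.lt_floor_add_one _
  have hcard : κ' - κ - 1 ≤ ((Finset.Icc a b).card : ℝ) := by
    rw [Nat.card_Icc, Nat.cast_sub]
    · push_cast; linarith
    · have : (a : ℝ) < b + 1 := by linarith
      exact_mod_cast this.le
  -- The strict `κ' < n/2` keeps `k > 0`, as the Stirling estimate requires.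
  have hmem : ∀ k ∈ Finset.Icc a b, κ ≤ (n : ℝ) / 2 - k ∧ (n : ℝ) / 2 - k ≤ κ' ∧ 0 < k ∧ k < n := by
    intro k hk
    rw [Finset.mem_Icc] at hk
    have h2 : (n : ℝ) / 2 - κ' ≤ k := Nat.ceil_le.1 hk.1
    have h3 : (k : ℝ) ≤ n / 2 - κ := (Nat.le_floor_iff (by linarith)).1 hk.2
    have h4 : (0 : ℝ) < k := by linarith
    have h5 : (k : ℝ) < n := by linarith
    exact ⟨by linarith, by linarith, by exact_mod_cast h4, by exact_mod_cast h5⟩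
  calc (κ' - κ - 1) * (3 / 5 / √n * Real.exp (-E))
      ≤ (Finset.Icc a b).card * (3 / 5 / √n * Real.exp (-E)) := by gcongr
    _ = ∑ _k ∈ Finset.Icc a b, (3 / 5 / √n * Real.exp (-E)) := by
        rw [Finset.sum_const, nsmul_eq_mul]
    _ ≤ ∑ k ∈ Finset.Icc a b, (n.choose k : ℝ) / 2 ^ n := by
        refine Finset.sum_le_sum fun k hk => ?_
        obtain ⟨h2, h3, h4, h5⟩ := hmem k hk
        refine le_trans ?_ (choose_div_two_pow_ge h4 h5)
        have h6 := hE (n / 2 - k) (by linarith) h3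
        rw [show ((n : ℝ) / 2 - k) / n = 1 / 2 - k / n by field_simp] at h6
        gcongr
    _ ≤ _ := by
        refine Finset.sum_le_sum_of_subset_of_nonneg (fun k hk => ?_) fun _ _ _ => by positivity
        obtain ⟨h2, h3, h4, h5⟩ := hmem k hk
        simp only [Finset.mem_filter, Finset.mem_range]
        exact ⟨by omega, h2⟩

/-! ### The explicit lower bound -/

theorem seven_le_const : (7 : ℝ) ≤ 3.1 * √(2 * Real.pi) := by
  have : (5 / 2 : ℝ) ≤ √(2 * Real.pi) :=
    Real.le_sqrt_of_sq_le (by linarith [Real.pi_gt_d2])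
  norm_num at this ⊢
  linarith

/-- The argument of `psi` in `regretBound` lies in `[0, 1/2)`. -/
theorem psi_arg_lt {n : ℕ} {l : ℝ} (hn : 0 < n) (hl : l ≤ n / 3) :
    1.6 * √l / (2 * √n) < 1 / 2 := by
  have hn' : (0 : ℝ) < √n := Real.sqrt_pos.2 (by exact_mod_cast hn)
  -- `0.6² = 0.36 > 1/3`, and then `0.8 · 0.6 = 0.48 < 1/2`.
  have h1 : √l ≤ 0.6 * √n := by
    refine Real.sqrt_le_iff.2 ⟨by positivity, ?_⟩
    rw [mul_pow, Real.sq_sqrt n.cast_nonneg]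
    have : (0 : ℝ) ≤ n := n.cast_nonneg
    norm_num
    linarith
  rw [div_lt_iff₀ (by positivity)]
  norm_num at h1 ⊢
  linarith

/-- The first factor is at most `5/14` and the bracket at most `5/2`; as `25/28 < 1`, the subtracted
`√n / 2` dominates. -/
theorem regretBound_nonpos {n d : ℕ} (hd : 2 ≤ d) (hl6 : Real.log d ≤ 6)
    (hln : Real.log d ≤ n / 3) : regretBound n d ≤ 0 := by
  have hl : (0.69 : ℝ) < Real.log d := by
    have : Real.log 2 ≤ Real.log d := Real.log_le_log two_pos (by exact_mod_cast hd)
    have := Real.log_two_gt_d9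
    norm_num at *
    linarith
  unfold regretBound
  set l := Real.log d with hldef
  have hl0 : 0 < l := by norm_num at hl; linarith
  have hn : 0 < n := by
    have : (0 : ℝ) < n := by linarith
    exact_mod_cast this
  have hpsi : 1 ≤ √(psi (1.6 * √l / (2 * √n))) := by
    rw [Real.one_le_sqrt]
    refine one_le_psi ?_
    rw [abs_of_nonneg (by positivity)]
    exact psi_arg_lt hn hln
  have hY : √(2 * l - 2 * Real.log l) - 1 ≤ 5 / 2 := by
    have : √(2 * l - 2 * Real.log l) ≤ 7 / 2 := by
      -- For `l ≥ 1` the radicand is at most `12 < 49/4`; for `l < 1`, `ln l ≥ 1 - 1/l ≥ -1` bounds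
      -- it by `4`.
      refine Real.sqrt_le_iff.2 ⟨by norm_num, ?_⟩
      rcases le_or_gt 1 l with h1 | h1
      · have := Real.log_nonneg h1
        linarith
      · have h2 := Real.one_sub_inv_le_log_of_pos hl0
        have h3 : l⁻¹ ≤ 2 := by
          rw [inv_le_comm₀ hl0 two_pos]; norm_num at hl ⊢; linarith
        linarith
    linarith
  have hs : √l ≤ 5 / 2 := Real.sqrt_le_iff.2 ⟨by norm_num, by linarith⟩
  have hc := seven_le_const
  set c := 3.1 * √(2 * Real.pi) with hcdef
  have hf : 1 - Real.exp (-(√l / c)) ≤ 5 / 14 := by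
    have h1 := Real.add_one_le_exp (-(√l / c))
    have h2 : √l / c ≤ 5 / 2 / 7 := by gcongr
    linarith
  have hf0 : 0 ≤ 1 - Real.exp (-(√l / c)) := by
    have : Real.exp (-(√l / c)) ≤ 1 := Real.exp_le_one_iff.2 (by
      have : 0 ≤ √l / c := by positivity
      linarith)
    linarith
  have hF : (1 - Real.exp (-(√l / c))) / √(psi (1.6 * √l / (2 * √n))) ≤ 5 / 14 :=
    (div_le_self hf0 hpsi).trans hf
  have hF0 : 0 ≤ (1 - Real.exp (-(√l / c))) / √(psi (1.6 * √l / (2 * √n))) := by positivity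
  have hn0 : 0 ≤ √(n : ℝ) := Real.sqrt_nonneg _
  set F := (1 - Real.exp (-(√l / c))) / √(psi (1.6 * √l / (2 * √n)))
  have h1 : F * (√n / 2) * (√(2 * l - 2 * Real.log l) - 1) ≤ F * (√n / 2) * (5 / 2) := by
    gcongr
  have h2 : F * (√n / 2) * (5 / 2) ≤ 5 / 14 * (√n / 2) * (5 / 2) := by gcongr
  linarith

theorem sum_regretBound_le {n d : ℕ} (hd : 2 ≤ d) (hl6 : 6 < Real.log d)
    (hln : Real.log d ≤ n / 3) :
    ∑ _b : Fin d → Finset (Fin n), regretBound n d ≤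
      ∑ b : Fin d → Finset (Fin n), halfRegret b := by
  unfold regretBound
  have hdpos : (0 : ℝ) < d := by positivity
  have hdl : Real.exp (Real.log d) = d := Real.exp_log hdpos
  set l := Real.log d with hldef
  have hl0 : 0 < l := by linarith
  have hnR : (18 : ℝ) < n := by linarith
  have hn : 0 < n := by
    have : (0 : ℝ) < n := by linarith
    exact_mod_cast this
  set x₀ := 1.6 * √l / (2 * √n) with hx₀
  have hx₀0 : 0 ≤ x₀ := by positivity
  have hx₀1 : x₀ < 1 / 2 := psi_arg_lt hn hln
  have habs : |x₀| < 1 / 2 := by rwa [abs_of_nonneg hx₀0]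
  have hψ1 := one_le_psi habs
  have hψ2 := psi_le_two habs
  set q := √(psi x₀) with hq
  have hqsq : q ^ 2 = psi x₀ := Real.sq_sqrt (by linarith)
  have hq1 : 1 ≤ q := by rw [hq, Real.one_le_sqrt]; exact hψ1
  have hq2 : q ≤ 1.42 := Real.sqrt_le_iff.2 ⟨by norm_num, by norm_num; linarith⟩
  set r := √(n : ℝ) with hr
  have hrsq : r ^ 2 = n := Real.sq_sqrt n.cast_nonneg
  have hr4 : 4.2 ≤ r := Real.le_sqrt_of_sq_le (by norm_num; linarith)
  have hr0 : 0 < r := by norm_num at hr4; linarith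
  have hlog0 : 0 ≤ Real.log l := Real.log_nonneg (by linarith)
  have hlog1 := Real.log_le_sub_one_of_pos hl0
  set Y := √(2 * l - 2 * Real.log l) with hY
  have hYsq : Y ^ 2 = 2 * l - 2 * Real.log l := Real.sq_sqrt (by linarith)
  have hY1 : 1 ≤ Y := by rw [hY, Real.one_le_sqrt]; linarith
  set s := √l with hs
  have hssq : s ^ 2 = l := Real.sq_sqrt hl0.le
  have hs2 : 2.4 ≤ s := Real.le_sqrt_of_sq_le (by norm_num; linarith)
  have hs0 : 0 < s := by norm_num at hs2; linarith
  -- `Y² ≤ 2l ≤ 1.6² l`; this puts `κ' / n` below the argument `x₀` of `psi`, so monotonicity of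
  -- `psi` applies on the whole window.
  have hYs : Y ≤ 1.6 * s := by
    refine abs_le_of_sq_le_sq' ?_ (by positivity) |>.2
    rw [mul_pow, hYsq, hssq]
    norm_num
    linarith
  have hκ' : r * Y / (2 * q) ≤ n * x₀ := by
    calc r * Y / (2 * q) ≤ r * (1.6 * s) / (2 * 1) := by gcongr
      _ = n * x₀ := by rw [hx₀, ← hrsq]; field_simp
  have hκ'n : r * Y / (2 * q) < n / 2 := by
    refine hκ'.trans_lt ?_
    have := mul_lt_mul_of_pos_left hx₀1 (show (0 : ℝ) < n by linarith)
    linarith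
  have hκ0 : 0 ≤ r * (Y - 1) / (2 * q) :=
    div_nonneg (mul_nonneg hr0.le (by linarith)) (by linarith)
  have hE : ∀ v : ℝ, 0 ≤ v → v ≤ r * Y / (2 * q) →
      n * bernoulliKL (1 / 2 + v / n) (1 / 2) ≤ l - Real.log l := by
    intro v hv0 hv
    have hn' : (0 : ℝ) < n := by linarith
    have hvn0 : 0 ≤ v / n := by positivity
    have hvn : v / n ≤ x₀ := by
      rw [div_le_iff₀ hn', mul_comm]
      exact hv.trans hκ'
    have h1 : psi (v / n) ≤ q ^ 2 := by
      rw [hqsq]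
      exact psi_le_psi hvn0 hvn hx₀1
    have h0 : 0 ≤ psi (v / n) :=
      zero_le_one.trans (one_le_psi (by rw [abs_of_nonneg hvn0]; exact hvn.trans_lt hx₀1))
    rw [bernoulliKL_half_eq]
    calc (n : ℝ) * (2 * (v / n) ^ 2 * psi (v / n))
        ≤ n * (2 * ((r * Y / (2 * q)) / n) ^ 2 * q ^ 2) := by gcongr
      _ = Y ^ 2 / 2 := by rw [← hrsq]; field_simp
      _ = _ := by rw [hYsq]; ring
  have htail : s / (7 * d) ≤ lowerTail n (r * (Y - 1) / (2 * q)) := by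
    refine le_trans ?_ (lowerTail_ge hκ0 hκ'n hE)
    rw [show -(l - Real.log l) = Real.log l - l by ring, Real.exp_sub, Real.exp_log hl0, hdl]
    -- `1 / 2.84 > 0.35`, and `r ≥ 4.2` gives `1 < 0.24 r`. Then `0.11 · 3/5 = 0.066`, and `s ≥ 2.4`
    -- absorbs one factor `s` into the `1/7`.
    have h1 : 0.11 * r ≤ r * Y / (2 * q) - r * (Y - 1) / (2 * q) - 1 := by
      have h2 : r / (2 * 1.42) ≤ r / (2 * q) := by gcongr
      have h3 : r * Y / (2 * q) - r * (Y - 1) / (2 * q) = r / (2 * q) := by ring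
      norm_num at h2 hr4 ⊢
      linarith
    calc s / (7 * d) ≤ 0.066 * s ^ 2 / d := by
          rw [div_le_div_iff₀ (by positivity) hdpos]
          have : s ≤ 0.462 * s ^ 2 := by norm_num at hs2 ⊢; nlinarith
          norm_num at this ⊢
          nlinarith
      _ = 0.11 * r * (3 / 5 / r * (l / d)) := by rw [hssq]; field_simp; norm_num
      _ ≤ _ := by gcongr
  refine le_trans (Finset.sum_le_sum fun _ _ => ?_) 
    (sum_halfRegret_ge (by omega) (r * (Y - 1) / (2 * q)))
  set p := lowerTail n (r * (Y - 1) / (2 * q)) with hp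
  have hp1 : p ≤ 1 := lowerTail_le_one _ _
  have hpow : (1 - p) ^ d ≤ Real.exp (-(s / (3.1 * √(2 * Real.pi)))) := by
    calc (1 - p) ^ d ≤ Real.exp (-p) ^ d :=
          pow_le_pow_left₀ (by linarith) (Real.one_sub_le_exp_neg p) d
      _ = Real.exp (-(d * p)) := by rw [← Real.exp_nat_mul]; ring_nf
      _ ≤ _ := by
          refine Real.exp_le_exp.2 (neg_le_neg ?_)
          calc s / (3.1 * √(2 * Real.pi)) ≤ s / 7 := by
                have := seven_le_const
                gcongr
            _ = d * (s / (7 * d)) := by field_simp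
            _ ≤ d * p := by gcongr
  have := mul_le_mul_of_nonneg_left
    (sub_le_sub_left hpow 1) hκ0
  calc _ = r * (Y - 1) / (2 * q) * (1 - Real.exp (-(s / (3.1 * √(2 * Real.pi))))) - r / 2 := by
        field_simp
    _ ≤ _ := by linarith

/-- Complementing all sets negates the centred size of action `0`, so its mean is zero, and the best
action is no worse. -/
theorem sum_halfRegret_nonneg {n d : ℕ} (hd : 0 < d) :
    0 ≤ ∑ b : Fin d → Finset (Fin n), halfRegret b := by
  have : NeZero d := ⟨hd.ne'⟩
  have h0 : ∑ b : Fin d → Finset (Fin n), ((n : ℝ) / 2 - (b 0).card) = 0 := by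
    have h := Equiv.sum_comp (Equiv.piCongrRight fun _ : Fin d =>
      (compl_involutive (α := Finset (Fin n))).toPerm) fun b => ((n : ℝ) / 2 - (b 0).card)
    have h2 : ∀ c : Finset (Fin n), (n : ℝ) / 2 - (cᶜ).card = -((n : ℝ) / 2 - c.card) := by
      intro c
      have := Finset.card_add_card_compl c
      rw [Fintype.card_fin] at this
      have : (c.card : ℝ) + (cᶜ).card = n := by exact_mod_cast this
      linarith
    simp only [Equiv.piCongrRight_apply, Pi.map_apply, Function.Involutive.coe_toPerm, h2,
      Finset.sum_neg_distrib] at h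
    linarith
  rw [← h0]
  exact Finset.sum_le_sum fun b _ => halfRegret_ge b 0

theorem ExpertAlgorithm.exists_regretBound_le {n d : ℕ} {Ω : Type*} [MeasurableSpace Ω]
    (A : ExpertAlgorithm d n Ω) (P : Measure Ω) [IsProbabilityMeasure P]
    (hd : 2 ≤ d) (hdn : (d : ℝ) ≤ Real.exp ((n : ℝ) / 3)) :
    ∃ l : LossSeq d n, (∀ t i, l t i = 0 ∨ l t i = 1) ∧
      regretBound n d ≤ ∫ ω, A.regret l ω ∂P := by
  have hln : Real.log d ≤ n / 3 := (Real.log_le_iff_le_exp (by positivity)).2 hdn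
  refine A.exists_le_integral_regret P ?_
  rcases le_or_gt (Real.log d) 6 with h | h
  · refine le_trans (Finset.sum_nonpos fun _ _ => regretBound_nonpos hd h hln)
      (sum_halfRegret_nonneg (by omega))
  · exact sum_regretBound_le hd h hln

/-! ### Asymptotics -/

/-- The limit of `regretBound n d / √(n/2 ln d)` as `n → ∞`, as a function of `l = ln d`. -/
noncomputable def regretRatio (l : ℝ) : ℝ :=
  ((1 - Real.exp (-(√l / (3.1 * √(2 * Real.pi))))) * (√(2 * l - 2 * Real.log l) - 1) - 1) / √(2 * l)

/-- Since `√(n/2 · l) = (√n / 2) √(2l)`, only the `psi` factor still depends on `n`, and its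
argument tends to `0`. -/
theorem tendsto_regretBound_div {d : ℕ} (hd : 2 ≤ d) :
    Tendsto (fun n : ℕ => regretBound n d / √((n : ℝ) / 2 * Real.log d)) atTop
      (𝓝 (regretRatio (Real.log d))) := by
  unfold regretBound regretRatio
  have hl : 0 < Real.log d := Real.log_pos (by exact_mod_cast hd)
  set l := Real.log d
  set F := 1 - Real.exp (-(√l / (3.1 * √(2 * Real.pi))))
  set Y := √(2 * l - 2 * Real.log l)
  have hsqrt : Tendsto (fun n : ℕ => 2 * √(n : ℝ)) atTop atTop :=
    (Real.tendsto_sqrt_atTop.comp tendsto_natCast_atTop_atTop).const_mul_atTop two_pos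
  have hpsi : Tendsto (fun n : ℕ => √(psi (1.6 * √l / (2 * √n)))) atTop (𝓝 1) := by
    have := (tendsto_psi_zero.comp (hsqrt.const_div_atTop (1.6 * √l))).sqrt
    simpa [Function.comp_def] using this
  have hlim : Tendsto (fun n : ℕ => (F / √(psi (1.6 * √l / (2 * √n))) * (Y - 1) - 1) / √(2 * l))
      atTop (𝓝 ((F * (Y - 1) - 1) / √(2 * l))) := by
    have := ((((tendsto_const_nhds (x := F)).div hpsi one_ne_zero).mul_const (Y - 1)).sub_const
      1).div_const (√(2 * l))
    simpa using this
  refine hlim.congr' ?_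
  filter_upwards [eventually_gt_atTop 0] with n hn
  have hn' : 0 < √(n : ℝ) := Real.sqrt_pos.2 (by exact_mod_cast hn)
  have hden : √((n : ℝ) / 2 * l) = √n / 2 * √(2 * l) := by
    rw [show (n : ℝ) / 2 * l = n / 4 * (2 * l) by ring, Real.sqrt_mul (by positivity),
      Real.sqrt_div (by positivity), show √(4 : ℝ) = 2 by
        rw [show (4 : ℝ) = 2 ^ 2 by norm_num]; exact Real.sqrt_sq zero_le_two]
  have h2l : 0 < √(2 * l) := by positivity
  rw [hden, div_eq_div_iff h2l.ne' (by positivity)]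
  ring

theorem tendsto_regretRatio : Tendsto regretRatio atTop (𝓝 1) := by
  have hc : 0 < 3.1 * √(2 * Real.pi) := lt_of_lt_of_le (by norm_num) seven_le_const
  have hF : Tendsto (fun l : ℝ => 1 - Real.exp (-(√l / (3.1 * √(2 * Real.pi))))) atTop (𝓝 1) := by
    have := (Real.tendsto_exp_neg_atTop_nhds_zero.comp
      (Real.tendsto_sqrt_atTop.atTop_div_const hc)).const_sub 1
    simpa [Function.comp_def] using this
  have hlog : Tendsto (fun l : ℝ => Real.log l / l) atTop (𝓝 0) :=
    Real.isLittleO_log_id_atTop.tendsto_div_nhds_zero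
  have hY : Tendsto (fun l : ℝ => √(1 - Real.log l / l)) atTop (𝓝 1) := by
    simpa using (hlog.const_sub 1).sqrt
  have hinv : Tendsto (fun l : ℝ => 1 / √(2 * l)) atTop (𝓝 0) :=
    (Real.tendsto_sqrt_atTop.comp (tendsto_id.const_mul_atTop two_pos)).const_div_atTop 1
  -- Dividing by `√(2l)` turns the ratio into `F (√(1 - ln l / l) - 1/√(2l)) - 1/√(2l)`, where `F`
  -- is the exponential factor.
  have hlim := (hF.mul (hY.sub hinv)).sub hinv
  simp only [sub_zero, mul_one] at hlim
  refine hlim.congr' ?_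
  filter_upwards [eventually_gt_atTop 0] with l hl
  have h2l : 0 < √(2 * l) := by positivity
  have hYeq : √(2 * l - 2 * Real.log l) = √(2 * l) * √(1 - Real.log l / l) := by
    rw [← Real.sqrt_mul (by positivity)]
    congr 1
    field_simp
  unfold regretRatio
  rw [hYeq]
  field_simp

theorem mainTheorem2 :
    (∀ n d : ℕ, 7 ≤ n → 2 ≤ d → (d : ℝ) ≤ Real.exp ((n : ℝ) / 3) →
      ∀ (Ω : Type*) [MeasurableSpace Ω] (P : Measure Ω) [IsProbabilityMeasure P]
        (A : ExpertAlgorithm d n Ω),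
        ∃ l : LossSeq d n, (∀ t i, l t i = 0 ∨ l t i = 1) ∧
          regretBound n d ≤ ∫ ω, A.regret l ω ∂P) ∧
    (∃ r : ℕ → ℝ,
      (∀ d : ℕ, 2 ≤ d →
        Tendsto (fun n : ℕ => regretBound n d / √((n : ℝ) / 2 * Real.log d)) atTop (𝓝 (r d))) ∧
      Tendsto r atTop (𝓝 1)) :=
  ⟨fun _ _ _ hd hdn _ _ P _ A => A.exists_regretBound_le P hd hdn,
    fun d => regretRatio (Real.log d), fun _ hd => tendsto_regretBound_div hd,
    tendsto_regretRatio.comp (Real.tendsto_log_atTop.comp tendsto_natCast_atTop_atTop)⟩
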